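/- Let $\Bbbk$ be a field and let $P$ be a finite simplicial poset, i.e. a finite poset with a least element $\hat 0$ in which every lower interval $P_{\le p}$ is a Boolean algebra. **Section ring.** For an order ideal (down-set) $\mathfrak a\subseteq P$ let $V_{\mathfrak a}$ be the set of atoms of $P$ lying in $\mathfrak a$, and let $$R_{\mathfrak a}=\Bbbk[x_v\mid v\in V_{\mathfrak a}]\Big/\Big(\prod_{v\in s}x_v \;\Big|\; s\subseteq V_{\mathfrak a},\ s\ne\{v \text{ atom}\mid v\le p\}\text{ for all }p\in\mathfrak a\Big).$$ Let $X(P)$ be the set of order ideals $\bigcap_{t\in\tau}P_{\le t}$, where $\tau$ runs over the nonempty sets of maximal elements of $P$, ordered by reverse inclusion; for these, $R_{\mathfrak a}$ is the Stanley–Reisner ring of the simplicial complex with face poset $\mathfrak a$. For $\mathfrak b\subseteq\mathfrak a$ let $R_{\mathfrak a}\to R_{\mathfrak b}$ be the natural projection ($x_v\mapsto x_v$ if $v\in\mathfrak b$, $x_v\mapsto 0$ otherwise). These data define a sheaf on $X(P)$, and $\mathcal R(P)$ is its $\Bbbk$-algebra of global sections, i.e. of families $(q_{\mathfrak a})_{\mathfrak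 a\in X(P)}\in\prod_{\mathfrak a}R_{\mathfrak a}$ compatible with the projections. **Stanley's face ring.** Let $S=\Bbbk[x_p\mid p\in P]/(x_{\hat 0}-1)$. For an order ideal $\mathfrak a$ of $P$ let $I_{\mathfrak a}\subseteq S$ be the ideal generated by the $x_p$ with $p\notin\mathfrak a$ and by $$x_px_q-x_{p\wedge q}\sum_{z}x_z\qquad(p,q\in\mathfrak a\text{ incomparable}),$$ where $z$ runs over the minimal common upper bounds of $p,q$ in $\mathfrak a$ (the generator being $x_px_q$ if there are none). Put $A_P=S/I_P$. Then: 1. There is an isomorphism of $\Bbbk$-algebras $A_P\cong\mathcal R(P)$ that sends the class of $x_p$ $(p\in P)$ to the section whose component at $\mathfrak a\in X(P)$ is $\prod_{v\le p,\ v\text{ atom}}x_v$ if $p\in\mathfrak a$, and $0$ if $p\notin\mathfrak a$. 2. For all order ideals $\mathfrak a,\mathfrak b$ of $P$, the ideal $I_{\mathfrak a}$ is radical, $I_{\mathfrak a}+I_{\mathfrak b}=I_{\mathfrak a\cap\mathfrak b}$ and $I_{\mathfrak a}\cap I_{\mathfrak b}=I_{\mathfrak a\cup\mathfrak b}$. In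 particular the ideals $I_{\mathfrak a}$ form a distributive lattice under sum and intersection: $I_{\mathfrak a}\cap(I_{\mathfrak b}+I_{\mathfrak c})=(I_{\mathfrak a}\cap I_{\mathfrak b})+(I_{\mathfrak a}\cap I_{\mathfrak c})$ for all order ideals $\mathfrak a,\mathfrak b,\mathfrak c$. -/

import Mathlib

/-- A finite-length, countable poset with a least element `⊥` (equivalently, in finite length:
a unique minimal element) is *simplicial* if every lower interval `P_{≤ p}` is a Boolean algebra,
that is, isomorphic to the poset of all subsets of an `n`-element set for some `n`. -/
structure IsSimplicialPoset (P : Type*) [PartialOrder P] [OrderBot P] : Prop where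
  countable : Countable P
  finiteLength : FiniteDimensionalOrder P
  boolean : ∀ p : P, ∃ n : ℕ, Nonempty (Set.Iic p ≃o Finset (Fin n))

namespace SimplicialPoset

open MvPolynomial

section StanleyReisner

/-- The ideal of `k[x_v | v ∈ V]` generated by the monomials of the non-faces of a family
`faces` of finite subsets of `V`. -/
noncomputable def stanleyReisnerIdeal (k : Type*) [Field k] {V : Type*}
    (faces : Set (Finset V)) : Ideal (MvPolynomial V k) :=
  Ideal.span {m | ∃ s : Finset V, s ∉ faces ∧ m = ∏ v ∈ s, X v}

/-- The Stanley-Reisner ring `k[x_v | v ∈ V] / (∏_{v ∈ s} x_v | s not a face)`. -/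
abbrev StanleyReisnerRing (k : Type*) [Field k] {V : Type*} (faces : Set (Finset V)) : Type _ :=
  MvPolynomial V k ⧸ stanleyReisnerIdeal k faces

end StanleyReisner

section Sheaf

variable {P : Type*} [PartialOrder P] [OrderBot P]

/-- The atoms of `P` that lie in the order ideal `a`. -/
abbrev Vert (a : LowerSet P) : Type _ := {v : P // IsAtom v ∧ v ∈ a}

/-- The faces of the simplicial complex with vertex set `Vert a` given by the order ideal `a`:
the vertex sets `{v atom | v ≤ p}` of the elements `p ∈ a`. -/
def faces (a : LowerSet P) : Set (Finset (Vert a)) :=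
  {s | ∃ p ∈ a, ∀ v : Vert a, v ∈ s ↔ v.1 ≤ p}

/-- The order ideal `⋂_{t ∈ τ} P_{≤ t}`. -/
def down (τ : Set P) : LowerSet P := ⨅ t ∈ τ, LowerSet.Iic t

variable (P) in
/-- The set of all order ideals `⋂_{t ∈ τ} P_{≤ t}` with `τ` a nonempty set of maximal
elements of `P`. -/
@[ext] structure XPoset where
  ideal : LowerSet P
  exists_eq_down : ∃ τ : Set P, τ.Nonempty ∧ (∀ t ∈ τ, IsMax t) ∧ ideal = down τ

/-- The ideals are ordered by reverse inclusion. -/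
instance : PartialOrder (XPoset P) where
  le a b := b.ideal ≤ a.ideal
  le_refl a := le_refl a.ideal
  le_trans _ _ _ h₁ h₂ := le_trans h₂ h₁
  le_antisymm _ _ h₁ h₂ := XPoset.ext (le_antisymm h₂ h₁)

variable (k : Type*) [Field k]

/-- The Stanley-Reisner ring of the simplicial complex given by the order ideal `a`. -/
abbrev idealRing (a : LowerSet P) : Type _ := StanleyReisnerRing k (faces a)

open Classical in
/-- The map of polynomial rings that sends `x_v` to `x_v` if `v ∈ b` and to `0` otherwise. -/
noncomputable def polyProj (a b : LowerSet P) :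
    MvPolynomial (Vert a) k →ₐ[k] MvPolynomial (Vert b) k :=
  aeval fun v => if h : v.1 ∈ b then X ⟨v.1, v.2.1, h⟩ else 0

theorem polyProj_mem {a b : LowerSet P} (h : b ≤ a) (f : MvPolynomial (Vert a) k)
    (hf : f ∈ stanleyReisnerIdeal k (faces a)) :
    polyProj k a b f ∈ stanleyReisnerIdeal k (faces b) := by
  classical
  suffices H : stanleyReisnerIdeal k (faces a) ≤
      (stanleyReisnerIdeal k (faces b)).comap (polyProj k a b) from H hf
  refine Ideal.span_le.2 ?_
  rintro _ ⟨s, hs, rfl⟩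
  change polyProj k a b (∏ v ∈ s, X v) ∈ stanleyReisnerIdeal k (faces b)
  rw [map_prod]
  by_cases hb : ∀ v ∈ s, v.1 ∈ b
  · refine Ideal.subset_span ⟨s.attach.image fun v => ⟨v.1.1, v.1.2.1, hb v.1 v.2⟩, ?_, ?_⟩
    · rintro ⟨p, hp, hps⟩
      refine hs ⟨p, h hp, fun v => ⟨fun hv => ?_, fun hv => ?_⟩⟩
      · exact (hps ⟨v.1, v.2.1, hb v hv⟩).1 (Finset.mem_image.2 ⟨⟨v, hv⟩, by simp, rfl⟩)
      · obtain ⟨w, -, hw⟩ := Finset.mem_image.1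
          ((hps ⟨v.1, v.2.1, b.lower hv hp⟩).2 hv)
        have : w.1 = v := Subtype.ext (congrArg (fun z : Vert b => z.1) hw)
        exact this ▸ w.2
    · rw [Finset.prod_image, ← Finset.prod_attach s]
      · refine Finset.prod_congr rfl fun v _ => ?_
        simp [polyProj, hb v.1 v.2]
      · intro v _ w _ hvw
        exact Subtype.ext (Subtype.ext (congrArg (fun z : Vert b => z.1) hvw))
  · push Not at hb
    obtain ⟨v, hv, hvb⟩ := hb
    rw [Finset.prod_eq_zero hv (by simp [polyProj, hvb])]
    exact Ideal.zero_mem _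

/-- The natural projection `R_a → R_b` for order ideals `b ⊆ a`. -/
noncomputable def proj {a b : LowerSet P} (h : b ≤ a) : idealRing k a →ₐ[k] idealRing k b :=
  Ideal.quotientMapₐ _ (polyProj k a b) fun f hf => polyProj_mem k h f hf

variable (P) in
/-- The Stanley-Reisner ring of `P`: the global sections of the sheaf on the poset `XPoset P`
given by the rings `idealRing k a` and the natural projections, that is, the `XPoset P`-tuples
compatible with the projections. -/
noncomputable def sectionRing : Subalgebra k (∀ a : XPoset P, idealRing k a.ideal) where
  carrier := {q | ∀ (a b : XPoset P) (h : a ≤ b), proj k h (q a) = q b}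
  mul_mem' hx hy a b h := by simp only [Pi.mul_apply, map_mul, hx a b h, hy a b h]
  add_mem' hx hy a b h := by simp only [Pi.add_apply, map_add, hx a b h, hy a b h]
  algebraMap_mem' r a b h := by simp only [Pi.algebraMap_apply, AlgHom.commutes]

/-- The class in `R_a` of the product of the variables `x_v` over all atoms `v ≤ p` in `a`. -/
noncomputable def faceMonomial [Finite P] (a : LowerSet P) (p : P) : idealRing k a :=
  Ideal.Quotient.mk _ (∏ v ∈ (Set.toFinite {v : Vert a | v.1 ≤ p}).toFinset, X v)

end Sheaf

section Stanley

variable {P : Type*} [PartialOrder P] [OrderBot P]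

/-- The minimal common upper bounds of `p` and `q` in the order ideal `a`. -/
def minUpper (a : LowerSet P) (p q : P) : Set P :=
  {z | z ∈ a ∧ p ≤ z ∧ q ≤ z ∧ ¬ ∃ z' ∈ a, z' < z ∧ p ≤ z' ∧ q ≤ z'}

open Classical in
/-- The greatest lower bound of `p` and `q`. In a simplicial poset it exists as soon as `p` and
`q` have a common upper bound; where it does not exist, the value is `⊥`. -/
noncomputable def meet (p q : P) : P :=
  if h : ∃ m, IsGLB {p, q} m then h.choose else ⊥

variable (k : Type*) [Field k]

/-- The ideal of `k[x_p | p ∈ P]` attached to the order ideal `a`, before dehomogenization.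
Where `p` and `q` have no common upper bound in `a`, the sum is empty, and the generator is
`x_p x_q`. -/
noncomputable def homIdeal [Finite P] (a : LowerSet P) : Ideal (MvPolynomial P k) :=
  Ideal.span {f | ∃ p, p ∉ a ∧ f = X p} ⊔
  Ideal.span {f | ∃ p ∈ a, ∃ q ∈ a, ¬ p ≤ q ∧ ¬ q ≤ p ∧
    f = X p * X q - X (meet p q) * ∑ z ∈ (Set.toFinite (minUpper a p q)).toFinset, X z}

variable (P) in
/-- The dehomogenized polynomial ring `S = k[x_p | p ∈ P] / (x_⊥ - 1)`. -/
abbrev DehomRing : Type _ :=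
  MvPolynomial P k ⧸ Ideal.span {(X ⊥ - 1 : MvPolynomial P k)}

/-- The ideal `I_a` of `S`: the image of `homIdeal k a`. -/
noncomputable def posetIdeal [Finite P] (a : LowerSet P) : Ideal (DehomRing P k) :=
  (homIdeal k a).map (Ideal.Quotient.mk _)

variable (P) in
/-- Stanley's face ring `A_P = S / I_P`. -/
abbrev StanleyRing [Finite P] : Type _ := DehomRing P k ⧸ posetIdeal k (⊤ : LowerSet P)

variable (P) in
/-- The class of `x_p` in Stanley's face ring. -/
noncomputable def stanleyGen [Finite P] (p : P) : StanleyRing P k :=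
  Ideal.Quotient.mk _ (Ideal.Quotient.mk _ (X p))

end Stanley

end SimplicialPoset

/-! Everything is tested in charts. For `t : P`, `chart k t` sends `X q` to the product of the atoms
below `q` if `q ≤ t`, and to `0` otherwise. The key fact is that `f` represents an element of the
ideal of `a` iff all charts at elements of `a` kill it (`mk_mem_posetIdeal_iff`). Charts kill the
relations because below a fixed `t` everything is computed in a Boolean algebra. Conversely, the
relations straighten every polynomial into a sum of terms `x p * g_p` with `g_p` a polynomial in the
atoms below `p` (`mem_iSup_range`). The charts are triangular on such sums: at `p` only terms `q ≤
p` survive, and the atom monomial of `p` is not a zero divisor. So a sum killed by all charts is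
zero term by term (`aeval_eq_zero`). Radicality and intersections follow at once, as charts land in
domains. Sums need only that the ideal of `a` is that of `P` plus the variables outside `a`
(`homIdeal_eq`). Distributivity is then inherited from the lattice of order ideals. For the
isomorphism, a section amounts to a family of polynomials, one for each `p`, compatible under
restriction. Each such family comes from one polynomial in the `x_p` (`exists_chart_eq`), which
gives surjectivity; injectivity is the chart criterion for the full poset. -/

namespace SimplicialPoset

open MvPolynomial

/-! ### Elements below a common bound and their atom sets -/

section Order

variable {P : Type*} [PartialOrder P] [OrderBot P] [Finite P]

/-- The atoms below `p`. -/
noncomputable def atomsBelow (p : P) : Finset P := (Set.toFinite {v | IsAtom v ∧ v ≤ p}).toFinset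

@[simp] theorem mem_atomsBelow {p v : P} : v ∈ atomsBelow p ↔ IsAtom v ∧ v ≤ p := by
  simp [atomsBelow]

theorem atomsBelow_mono {p q : P} (h : p ≤ q) : atomsBelow p ⊆ atomsBelow q := fun v hv => by
  rw [mem_atomsBelow] at *
  exact ⟨hv.1, hv.2.trans h⟩

@[simp] theorem atomsBelow_bot : atomsBelow (⊥ : P) = ∅ := by
  ext v
  simp only [mem_atomsBelow, le_bot_iff, Finset.notMem_empty, iff_false, not_and]
  exact fun h => h.1

theorem atomsBelow_of_isAtom {v : P} (hv : IsAtom v) : atomsBelow v = {v} := by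
  ext w
  simp only [mem_atomsBelow, Finset.mem_singleton]
  constructor
  · rintro ⟨hw, h⟩
    exact (hv.le_iff.1 h).resolve_left hw.1
  · rintro rfl
    exact ⟨hv, le_rfl⟩

/-- In the Boolean algebra `P_{≤ t}` the atoms correspond to singletons, and a subset is determined
by its points. The common bound `t` is essential: distinct elements of `P` may have the same atoms.
-/
theorem le_of_atomsBelow_subset (hP : IsSimplicialPoset P) {p q t : P} (hp : p ≤ t) (hq : q ≤ t)
    (h : atomsBelow p ⊆ atomsBelow q) : p ≤ q := by
  obtain ⟨n, ⟨e⟩⟩ := hP.boolean t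
  have key : e ⟨p, hp⟩ ≤ e ⟨q, hq⟩ := by
    intro i hi
    have hat : IsAtom (e.symm {i}).1 :=
      ((e.symm.isAtom_iff _).2 (Finset.isAtom_singleton i)).of_isAtom_coe_Iic
    have h1 : e.symm {i} ≤ ⟨p, hp⟩ := by
      rw [e.symm_apply_le]
      simpa using hi
    have h2 := (mem_atomsBelow.1 (h (mem_atomsBelow.2 ⟨hat, h1⟩))).2
    have h3 : e.symm {i} ≤ ⟨q, hq⟩ := h2
    rw [e.symm_apply_le] at h3
    simpa using h3
  exact e.le_iff_le.1 key

theorem eq_of_atomsBelow_eq (hP : IsSimplicialPoset P) {p q t : P} (hp : p ≤ t) (hq : q ≤ t)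
    (h : atomsBelow p = atomsBelow q) : p = q :=
  le_antisymm (le_of_atomsBelow_subset hP hp hq h.subset)
    (le_of_atomsBelow_subset hP hq hp h.superset)

theorem exists_atomsBelow_eq (hP : IsSimplicialPoset P) {t : P} {s : Finset P}
    (hs : s ⊆ atomsBelow t) :
    ∃ p ≤ t, atomsBelow p = s := by
  classical
  obtain ⟨n, ⟨e⟩⟩ := hP.boolean t
  set F : Finset (Fin n) := Finset.univ.filter fun i => (e.symm {i}).1 ∈ s with hF
  refine ⟨(e.symm F).1, (e.symm F).2, ?_⟩
  have main : ∀ v (hv : IsAtom v) (hvt : v ≤ t), v ≤ (e.symm F).1 ↔ v ∈ s := by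
    intro v hv hvt
    have h1 : IsAtom (⟨v, hvt⟩ : Set.Iic t) := hv.Iic hvt
    obtain ⟨i, hi⟩ := Finset.isAtom_iff.1 ((e.isAtom_iff _).2 h1)
    have h2 : e.symm {i} = ⟨v, hvt⟩ := by rw [← hi, e.symm_apply_apply]
    have h3 : v ≤ (e.symm F).1 ↔ (⟨v, hvt⟩ : Set.Iic t) ≤ e.symm F := Iff.rfl
    rw [h3, e.le_symm_apply, hi]
    simp [hF, h2]
  ext v
  rw [mem_atomsBelow]
  constructor
  · rintro ⟨hv, h⟩
    exact (main v hv (h.trans (e.symm F).2)).1 h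
  · intro hv
    have := mem_atomsBelow.1 (hs hv)
    exact ⟨this.1, (main v this.1 this.2).2 hv⟩

theorem isGLB_meet (hP : IsSimplicialPoset P) {p q t : P} (hp : p ≤ t) (hq : q ≤ t) :
    IsGLB {p, q} (meet p q) := by
  classical
  have h : ∃ m, IsGLB {p, q} m := by
    obtain ⟨m, hm, hms⟩ := exists_atomsBelow_eq hP
      (s := atomsBelow p ∩ atomsBelow q) (t := t)
      (Finset.inter_subset_left.trans (atomsBelow_mono hp))
    refine ⟨m, ?_, ?_⟩
    · rintro _ (rfl | rfl)
      · exact le_of_atomsBelow_subset hP hm hp (hms ▸ Finset.inter_subset_left)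
      · exact le_of_atomsBelow_subset hP hm hq (hms ▸ Finset.inter_subset_right)
    · intro r hr
      have h1 : r ≤ p := hr (by simp)
      have h2 : r ≤ q := hr (by simp)
      refine le_of_atomsBelow_subset hP (h1.trans hp) hm ?_
      rw [hms]
      exact Finset.subset_inter (atomsBelow_mono h1) (atomsBelow_mono h2)
  rw [meet, dif_pos h]
  exact h.choose_spec

theorem meet_le_left (hP : IsSimplicialPoset P) {p q t : P} (hp : p ≤ t)
    (hq : q ≤ t) : meet p q ≤ p :=
  (isGLB_meet hP hp hq).1 (by simp)

theorem meet_le_right (hP : IsSimplicialPoset P) {p q t : P} (hp : p ≤ t)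
    (hq : q ≤ t) : meet p q ≤ q :=
  (isGLB_meet hP hp hq).1 (by simp)

open Classical in
theorem atomsBelow_meet (hP : IsSimplicialPoset P) {p q t : P} (hp : p ≤ t) (hq : q ≤ t) :
    atomsBelow (meet p q) = atomsBelow p ∩ atomsBelow q := by
  refine subset_antisymm (Finset.subset_inter (atomsBelow_mono (meet_le_left hP hp hq))
    (atomsBelow_mono (meet_le_right hP hp hq))) fun v hv => ?_
  rw [Finset.mem_inter, mem_atomsBelow, mem_atomsBelow] at hv
  refine mem_atomsBelow.2 ⟨hv.1.1, (isGLB_meet hP hp hq).2 ?_⟩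
  rintro _ (rfl | rfl)
  exacts [hv.1.2, hv.2.2]

-- The element below `z` whose atoms are those of `p` and `q` together is already a common upper
-- bound, so minimality forces it to be `z`. Hence there is exactly one minimal bound below each
-- common bound.
open Classical in
theorem mem_minUpper_iff (hP : IsSimplicialPoset P) {a : LowerSet P} {p q z : P} :
    z ∈ minUpper a p q ↔
      z ∈ a ∧ p ≤ z ∧ q ≤ z ∧ atomsBelow z = atomsBelow p ∪ atomsBelow q := by
  constructor
  · rintro ⟨hz, hpz, hqz, hmin⟩
    refine ⟨hz, hpz, hqz, ?_⟩
    obtain ⟨j, hj, hjs⟩ := exists_atomsBelow_eq hP (t := z)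
      (Finset.union_subset (atomsBelow_mono hpz) (atomsBelow_mono hqz))
    rcases hj.eq_or_lt with rfl | hlt
    · exact hjs
    · exact absurd ⟨j, a.lower hj hz, hlt,
        le_of_atomsBelow_subset hP hpz hj (hjs ▸ Finset.subset_union_left),
        le_of_atomsBelow_subset hP hqz hj (hjs ▸ Finset.subset_union_right)⟩ hmin
  · rintro ⟨hz, hpz, hqz, hzs⟩
    refine ⟨hz, hpz, hqz, ?_⟩
    rintro ⟨z', -, hlt, hp, hq⟩
    refine hlt.not_ge (le_of_atomsBelow_subset hP le_rfl hlt.le ?_)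
    rw [hzs]
    exact Finset.union_subset (atomsBelow_mono hp) (atomsBelow_mono hq)

theorem exists_mem_minUpper (hP : IsSimplicialPoset P) {a : LowerSet P} {p q t : P} (ht : t ∈ a)
    (hp : p ≤ t) (hq : q ≤ t) :
    ∃ z ∈ minUpper a p q, z ≤ t := by
  classical
  obtain ⟨j, hj, hjs⟩ := exists_atomsBelow_eq hP (t := t)
    (Finset.union_subset (atomsBelow_mono hp) (atomsBelow_mono hq))
  exact ⟨j, (mem_minUpper_iff hP).2 ⟨a.lower hj ht,
    le_of_atomsBelow_subset hP hp hj (hjs ▸ Finset.subset_union_left),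
    le_of_atomsBelow_subset hP hq hj (hjs ▸ Finset.subset_union_right), hjs⟩, hj⟩

theorem eq_of_mem_minUpper (hP : IsSimplicialPoset P) {a : LowerSet P} {p q z w t : P}
    (hz : z ∈ minUpper a p q)
    (hw : w ∈ minUpper a p q) (hzt : z ≤ t) (hwt : w ≤ t) : z = w := by
  classical
  exact eq_of_atomsBelow_eq hP hzt hwt
    (((mem_minUpper_iff hP).1 hz).2.2.2.trans ((mem_minUpper_iff hP).1 hw).2.2.2.symm)

-- Peeling one atom off `q` supplies the induction step of `mul_eq_mul_prod`.
open Classical in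
theorem exists_mem_minUpper_isAtom (hP : IsSimplicialPoset P) {q : P} (hq : q ≠ ⊥) :
    ∃ v r, IsAtom v ∧ r < q ∧ q ∈ minUpper ⊤ v r ∧ v ∉ atomsBelow r ∧ atomsBelow q = insert v (atomsBelow r) ∧
      meet v r = ⊥ := by
  classical
  have hne : (atomsBelow q).Nonempty := by
    rw [Finset.nonempty_iff_ne_empty]
    intro h
    exact hq (eq_of_atomsBelow_eq hP le_rfl bot_le (h.trans atomsBelow_bot.symm))
  obtain ⟨v, hv⟩ := hne
  have hva := mem_atomsBelow.1 hv
  obtain ⟨r, hr, hrs⟩ := exists_atomsBelow_eq hP (t := q) (Finset.erase_subset v _)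
  have hvr : v ∉ atomsBelow r := by simp [hrs]
  have hins : atomsBelow q = insert v (atomsBelow r) := by rw [hrs, Finset.insert_erase hv]
  refine ⟨v, r, hva.1, lt_of_le_of_ne hr ?_, ?_, hvr, hins, ?_⟩
  · rintro rfl
    exact hvr hv
  · exact (mem_minUpper_iff hP).2 ⟨trivial, hva.2, hr, by
      rw [atomsBelow_of_isAtom hva.1, hins, Finset.insert_eq]⟩
  · refine eq_of_atomsBelow_eq hP (meet_le_right hP hva.2 hr) bot_le ?_
    rw [atomsBelow_meet hP hva.2 hr, atomsBelow_of_isAtom hva.1, atomsBelow_bot,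
      Finset.singleton_inter_of_notMem hvr]

end Order

/-! ### Charts and their compatibility with Stanley's relations -/

section Charts

variable {P : Type*} [PartialOrder P] [OrderBot P] [Finite P] (k : Type*) [Field k]

/-- The squarefree monomial of the atoms below `p`. -/
noncomputable def atomMonomial (p : P) : MvPolynomial P k := ∏ v ∈ atomsBelow p, X v

open Classical in
/-- The endomorphism of `k[x_p | p ∈ P]` that keeps the variables of the atoms below `p` and
kills all others. -/
noncomputable def restrict (p : P) : MvPolynomial P k →ₐ[k] MvPolynomial P k :=
  aeval fun v => if v ∈ atomsBelow p then X v else 0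

open Classical in
/-- The map `k[x_p | p ∈ P] → k[x_v | v ≤ t]` sending `x_q` to the product of the atoms below `q`
if `q ≤ t` and to `0` otherwise. -/
noncomputable def chart (t : P) : MvPolynomial P k →ₐ[k] MvPolynomial P k :=
  aeval fun q => if q ≤ t then atomMonomial k q else 0

theorem atomMonomial_ne_zero (p : P) : atomMonomial k p ≠ 0 :=
  Finset.prod_ne_zero_iff.2 fun _ _ => X_ne_zero _

@[simp] theorem atomMonomial_bot : atomMonomial k (⊥ : P) = 1 := by simp [atomMonomial]

open Classical in
theorem restrict_X (p v : P) : restrict k p (X v) = if v ∈ atomsBelow p then X v else 0 := by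
  simp [restrict]

open Classical in
theorem chart_X (t q : P) : chart k t (X q) = if q ≤ t then atomMonomial k q else 0 := by
  simp [chart]

theorem chart_X_of_le {t q : P} (h : q ≤ t) : chart k t (X q) = atomMonomial k q := by
  simp [chart_X, h]

theorem chart_X_of_not_le {t q : P} (h : ¬ q ≤ t) : chart k t (X q) = 0 := by
  simp [chart_X, h]

theorem restrict_atomMonomial_of_le {p q : P} (h : q ≤ p) :
    restrict k p (atomMonomial k q) = atomMonomial k q := by
  rw [atomMonomial, map_prod]
  refine Finset.prod_congr rfl fun v hv => ?_
  rw [restrict_X, if_pos (atomsBelow_mono h hv)]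

theorem restrict_atomMonomial_of_not_subset {p q : P} (h : ¬ atomsBelow q ⊆ atomsBelow p) :
    restrict k p (atomMonomial k q) = 0 := by
  obtain ⟨v, hv, hvp⟩ := Finset.not_subset.1 h
  rw [atomMonomial, map_prod]
  exact Finset.prod_eq_zero hv (by rw [restrict_X, if_neg hvp])

theorem restrict_comp_restrict {p q : P} (h : q ≤ p) (f : MvPolynomial P k) :
    restrict k q (restrict k p f) = restrict k q f := by
  suffices H : (restrict k q).comp (restrict k p) = restrict k q from DFunLike.congr_fun H f
  refine algHom_ext fun v => ?_
  rw [AlgHom.comp_apply, restrict_X, restrict_X]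
  by_cases h1 : v ∈ atomsBelow p
  · rw [if_pos h1, restrict_X]
  · rw [if_neg h1, if_neg fun h2 => h1 (atomsBelow_mono h h2), map_zero]

theorem restrict_chart (hP : IsSimplicialPoset P) {t p : P} (h : p ≤ t) (f : MvPolynomial P k) :
    restrict k p (chart k t f) = chart k p f := by
  suffices H : (restrict k p).comp (chart k t) = chart k p from DFunLike.congr_fun H f
  refine algHom_ext fun q => ?_
  rw [AlgHom.comp_apply]
  by_cases hq : q ≤ t
  · rw [chart_X_of_le k hq]
    by_cases hqp : q ≤ p
    · rw [chart_X_of_le k hqp, restrict_atomMonomial_of_le k hqp]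
    · rw [chart_X_of_not_le k hqp, restrict_atomMonomial_of_not_subset]
      exact fun hs => hqp (le_of_atomsBelow_subset hP hq h hs)
  · rw [chart_X_of_not_le k hq, chart_X_of_not_le k fun hqp => hq (hqp.trans h), map_zero]

/-- If `p, q ≤ t`, exactly one minimal upper bound lies below `t`, and the relation becomes the
identity between the product over two sets and that over their union and intersection. Otherwise
every term vanishes. -/
theorem chart_relation (hP : IsSimplicialPoset P) (t : P) {a : LowerSet P} (ht : t ∈ a) (p q : P) :
    chart k t (X p * X q - X (meet p q) *
      ∑ z ∈ (Set.toFinite (minUpper a p q)).toFinset, X z) = 0 := by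
  classical
  rw [map_sub, map_mul, map_mul, map_sum, sub_eq_zero]
  by_cases h : p ≤ t ∧ q ≤ t
  · obtain ⟨hp, hq⟩ := h
    obtain ⟨z, hz, hzt⟩ := exists_mem_minUpper hP ht hp hq
    rw [Finset.sum_eq_single_of_mem z (by simpa using hz), chart_X_of_le k hp,
      chart_X_of_le k hq, chart_X_of_le k hzt,
      chart_X_of_le k ((meet_le_left hP hp hq).trans hp), mul_comm (atomMonomial k (meet p q))]
    · simp only [atomMonomial]
      rw [((mem_minUpper_iff hP).1 hz).2.2.2, atomsBelow_meet hP hp hq, Finset.prod_union_inter]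
    · intro w hw hwz
      refine chart_X_of_not_le k fun hwt => hwz ?_
      exact eq_of_mem_minUpper hP (by simpa using hw) hz hwt hzt
  · rw [Finset.sum_eq_zero, mul_zero]
    · rcases not_and_or.1 h with h | h
      · rw [chart_X_of_not_le k h, zero_mul]
      · rw [chart_X_of_not_le k h, mul_zero]
    · intro z hz
      have hz' : z ∈ minUpper a p q := by simpa using hz
      exact chart_X_of_not_le k fun hzt => h ⟨hz'.2.1.trans hzt, hz'.2.2.1.trans hzt⟩

theorem homIdeal_le_ker_chart (hP : IsSimplicialPoset P) {t : P} {a : LowerSet P} (ht : t ∈ a) :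
    homIdeal k a ⊔ Ideal.span {X ⊥ - 1} ≤ RingHom.ker (chart k t) := by
  refine sup_le (sup_le ?_ ?_) ?_ <;> refine Ideal.span_le.2 ?_
  · rintro _ ⟨p, hp, rfl⟩
    exact chart_X_of_not_le k fun h => hp (a.lower h ht)
  · rintro _ ⟨p, -, q, -, -, -, rfl⟩
    exact chart_relation k hP t ht p q
  · rintro _ rfl
    change chart k t (X ⊥ - 1) = 0
    rw [map_sub, chart_X_of_le k bot_le, atomMonomial_bot, map_one, sub_self]

/-- The ideal of `a` is obtained from the ideal of `P` by killing the variables outside `a`. -/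
theorem homIdeal_eq (a : LowerSet P) :
    homIdeal k a = homIdeal k ⊤ ⊔ Ideal.span {f | ∃ p, p ∉ a ∧ f = X p} := by
  classical
  set J := Ideal.span {f : MvPolynomial P k | ∃ p, p ∉ a ∧ f = X p} with hJ
  have hX : ∀ p, p ∉ a → (X p : MvPolynomial P k) ∈ J := fun p hp =>
    Ideal.subset_span ⟨p, hp, rfl⟩
  -- Since `a` is a lower set, the minimal upper bounds in `a` are those in `P` that lie in `a`; the
  -- two sums differ by variables outside `a`.
  have key : ∀ p q, X (meet p q) * ∑ z ∈ (Set.toFinite (minUpper ⊤ p q)).toFinset, X z -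
      X (meet p q) * ∑ z ∈ (Set.toFinite (minUpper a p q)).toFinset, X z ∈ J := by
    intro p q
    have hsub : (Set.toFinite (minUpper a p q)).toFinset ⊆
        (Set.toFinite (minUpper ⊤ p q)).toFinset := by
      intro z hz
      simp only [Set.Finite.mem_toFinset] at hz ⊢
      obtain ⟨hz, hp, hq, hmin⟩ := hz
      exact ⟨trivial, hp, hq, fun ⟨z', _, hlt, h⟩ => hmin ⟨z', a.lower hlt.le hz, hlt, h⟩⟩
    rw [← mul_sub, ← Finset.sum_sdiff hsub, add_sub_cancel_right]
    refine Ideal.mul_mem_left _ _ (Ideal.sum_mem _ fun z hz => hX z fun hza => ?_)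
    simp only [Finset.mem_sdiff, Set.Finite.mem_toFinset] at hz
    obtain ⟨⟨-, hp, hq, hmin⟩, hz⟩ := hz
    exact hz ⟨hza, hp, hq, fun ⟨z', _, h⟩ => hmin ⟨z', trivial, h⟩⟩
  apply le_antisymm
  · refine sup_le le_sup_right (Ideal.span_le.2 ?_)
    rintro _ ⟨p, -, q, -, hpq, hqp, rfl⟩
    rw [← sub_add_sub_cancel _ (X (meet p q) *
      ∑ z ∈ (Set.toFinite (minUpper ⊤ p q)).toFinset, X z) (X (meet p q) *
      ∑ z ∈ (Set.toFinite (minUpper a p q)).toFinset, X z)]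
    exact Ideal.add_mem _ (Ideal.mem_sup_left (Ideal.mem_sup_right
      (Ideal.subset_span ⟨p, trivial, q, trivial, hpq, hqp, rfl⟩)))
      (Ideal.mem_sup_right (key p q))
  · refine sup_le (sup_le (Ideal.span_le.2 ?_) (Ideal.span_le.2 ?_)) le_sup_left
    · rintro _ ⟨p, hp, rfl⟩
      exact absurd trivial hp
    · rintro _ ⟨p, -, q, -, hpq, hqp, rfl⟩
      by_cases h : p ∈ a ∧ q ∈ a
      · rw [← sub_sub_sub_cancel_right _ _ (X (meet p q) *
          ∑ z ∈ (Set.toFinite (minUpper a p q)).toFinset, X z)]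
        exact Ideal.sub_mem _ (Ideal.mem_sup_right
          (Ideal.subset_span ⟨p, h.1, q, h.2, hpq, hqp, rfl⟩)) (Ideal.mem_sup_left (key p q))
      · have hz : ∀ z ∈ (Set.toFinite (minUpper ⊤ p q)).toFinset, (X z : MvPolynomial P k) ∈ J := by
          intro z hz
          simp only [Set.Finite.mem_toFinset] at hz
          exact hX z fun hza => h ⟨a.lower hz.2.1 hza, a.lower hz.2.2.1 hza⟩
        refine Ideal.mem_sup_left (Ideal.sub_mem _ ?_
          (Ideal.mul_mem_left _ _ (Ideal.sum_mem _ hz)))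
        rcases not_and_or.1 h with h | h
        · exact Ideal.mul_mem_right _ _ (hX p h)
        · exact Ideal.mul_mem_left _ _ (hX q h)

end Charts

/-! ### Straightening and triangularity -/

section Spanning

variable {P : Type*} [PartialOrder P] [OrderBot P] {k : Type*} [Field k]
  {B : Type*} [CommRing B] [Algebra k B]

variable (k) in
open Classical in
/-- Evaluation of a polynomial in the atoms below `p`. -/
noncomputable def atomEval [Finite P] (x : P → B) (p : P) : MvPolynomial P k →ₐ[k] B :=
  aeval fun v => if v ∈ atomsBelow p then x v else 0

theorem atomEval_X_of_mem [Finite P] {x : P → B} {p v : P} (h : v ∈ atomsBelow p) :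
    atomEval k x p (X v) = x v := by
  simp only [atomEval, aeval_X, if_pos h]

theorem atomEval_restrict [Finite P] (x : P → B) {p q : P} (h : p ≤ q) (g : MvPolynomial P k) :
    atomEval k x q (restrict k p g) = atomEval k x p g := by
  suffices H : (atomEval k x q).comp (restrict k p) = atomEval k x p from DFunLike.congr_fun H g
  refine algHom_ext fun v => ?_
  rw [AlgHom.comp_apply, restrict_X]
  by_cases hv : v ∈ atomsBelow p
  · rw [if_pos hv, atomEval_X_of_mem hv, atomEval_X_of_mem (atomsBelow_mono h hv)]
  · rw [if_neg hv, map_zero]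
    simp only [atomEval, aeval_X, if_neg hv]

/-- The elements `x p` of a ring satisfy Stanley's relations. -/
structure IsStanleyFamily [Finite P] (x : P → B) : Prop where
  bot : x ⊥ = 1
  mul : ∀ p q, ¬ p ≤ q → ¬ q ≤ p →
    x p * x q = x (meet p q) * ∑ z ∈ (Set.toFinite (minUpper ⊤ p q)).toFinset, x z

namespace IsStanleyFamily

variable [Finite P] {x : P → B}

theorem mul_eq_zero (hx : IsStanleyFamily x) {p q : P} (h : ∀ z, p ≤ z → ¬ q ≤ z) :
    x p * x q = 0 := by
  rw [hx.mul p q (fun hpq => h q hpq le_rfl) fun hqp => h p le_rfl hqp, Finset.sum_eq_zero,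
    mul_zero]
  intro z hz
  simp only [Set.Finite.mem_toFinset] at hz
  exact absurd hz.2.2.1 (h z hz.2.1)

/-- Write `q` as a minimal upper bound of an atom `v` and some `r < q`. The factor `x p` selects `q`
in the relation for `x v * x r`: another minimal bound has no upper bound in common with `p`, as two
of them cannot lie below the same element. -/
theorem mul_eq_mul_prod (hx : IsStanleyFamily x) (hP : IsSimplicialPoset P) {p q : P} (h : q ≤ p) :
    x p * x q = x p * ∏ v ∈ atomsBelow q, x v := by
  classical
  induction q using WellFoundedLT.induction with
  | ind q ih =>
    by_cases hq : q = ⊥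
    · simp [hq, hx.bot]
    obtain ⟨v, r, hv, hr, hqm, hvr, hins, hmeet⟩ := exists_mem_minUpper_isAtom hP hq
    rw [hins, Finset.prod_insert hvr, mul_left_comm, ← ih r hr (hr.le.trans h), mul_left_comm]
    -- The relation is available only for incomparable elements; `r ≤ v` leaves just the case where
    -- `q` is an atom.
    by_cases hrv : r ≤ v
    · have : r = ⊥ := by
        rcases hv.le_iff.1 hrv with h | h
        · exact h
        · exact absurd (by simp [h, hv]) hvr
      subst this
      have : q = v := by
        refine eq_of_atomsBelow_eq hP le_rfl hqm.2.1 ?_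
        rw [hins, atomsBelow_of_isAtom hv, atomsBelow_bot]
        rfl
      rw [this, hx.bot, mul_one]
    · have hvr' : ¬ v ≤ r := fun h => hvr (mem_atomsBelow.2 ⟨hv, h⟩)
      rw [hx.mul v r hvr' hrv, hmeet, hx.bot, one_mul, Finset.mul_sum,
        Finset.sum_eq_single_of_mem q (by simpa using hqm)]
      intro z hz hzq
      simp only [Set.Finite.mem_toFinset] at hz
      exact hx.mul_eq_zero fun y hpy hzy => hzq (eq_of_mem_minUpper hP hz hqm hzy (h.trans hpy))

theorem mul_mul_atomEval (hx : IsStanleyFamily x) (hP : IsSimplicialPoset P) {p q : P} (h : q ≤ p)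
    (g : MvPolynomial P k) :
    x p * x q * atomEval k x p g = x p * atomEval k x p (atomMonomial k q * g) := by
  rw [hx.mul_eq_mul_prod hP h, map_mul, atomMonomial, map_prod, mul_assoc]
  congr 2
  exact Finset.prod_congr rfl fun v hv => (atomEval_X_of_mem (atomsBelow_mono h hv)).symm

/-- The span contains the constants and is stable under multiplication by each `x q`. If `p` and `q`
are comparable, the smaller factor is absorbed as a monomial in atoms; if not, the relation moves
the term to the minimal upper bounds. -/
theorem mem_iSup_range (hx : IsStanleyFamily x) (hP : IsSimplicialPoset P) (f : MvPolynomial P k) :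
    aeval x f ∈ ⨆ p, LinearMap.range
      (LinearMap.mulLeft k (x p) ∘ₗ (atomEval k x p).toLinearMap) := by
  classical
  set N := ⨆ p, LinearMap.range (LinearMap.mulLeft k (x p) ∘ₗ (atomEval k x p).toLinearMap) with hN
  have hmem : ∀ p g, x p * atomEval k x p g ∈ N := fun p g =>
    Submodule.mem_iSup_of_mem p ⟨g, rfl⟩
  induction f using MvPolynomial.induction_on with
  | C c =>
    have := hmem ⊥ (C c)
    rw [hx.bot, one_mul, algHom_C] at this
    rwa [algHom_C]
  | add f g hf hg =>
    rw [map_add]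
    exact N.add_mem hf hg
  | mul_X f q hf =>
    rw [map_mul, aeval_X]
    refine Submodule.iSup_induction _ (motive := fun b => b * x q ∈ N) hf ?_ (by simp) ?_
    · rintro p _ ⟨g, rfl⟩
      change x p * atomEval k x p g * x q ∈ N
      rw [mul_right_comm]
      by_cases hqp : q ≤ p
      · rw [hx.mul_mul_atomEval hP hqp]
        exact hmem _ _
      by_cases hpq : p ≤ q
      · rw [← atomEval_restrict x hpq, mul_comm (x p), hx.mul_mul_atomEval hP hpq]
        exact hmem _ _
      rw [hx.mul p q hpq hqp, Finset.mul_sum, Finset.sum_mul]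
      refine N.sum_mem fun z hz => ?_
      simp only [Set.Finite.mem_toFinset] at hz
      rw [← atomEval_restrict x hz.2.1, mul_comm (x _), hx.mul_mul_atomEval hP
        ((meet_le_left hP hz.2.1 hz.2.2.1).trans hz.2.1)]
      exact hmem _ _
    · intro a b ha hb
      rw [add_mul]
      exact N.add_mem ha hb

theorem exists_eq_sum (hx : IsStanleyFamily x) [Fintype P] (hP : IsSimplicialPoset P)
    (f : MvPolynomial P k) :
    ∃ g : P → MvPolynomial P k, aeval x f = ∑ p, x p * atomEval k x p (g p) := by
  have h := hx.mem_iSup_range hP f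
  obtain ⟨b, hb, hsum⟩ := (Submodule.mem_iSup_iff_exists_finsupp _ _).1 h
  choose g hg using hb
  refine ⟨g, ?_⟩
  rw [← hsum, Finsupp.sum_fintype _ _ fun _ => rfl]
  exact Finset.sum_congr rfl fun p _ => (hg p).symm

/-- If the generators outside `a` vanish, a polynomial expression that vanishes in all charts at
elements of `a` is zero. -/
theorem aeval_eq_zero (hx : IsStanleyFamily x) (hP : IsSimplicialPoset P) (a : LowerSet P)
    (hxa : ∀ p, p ∉ a → x p = 0)
    (ρ : ∀ t ∈ a, B →ₐ[k] MvPolynomial P k)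
    (hρ : ∀ t ht q, ρ t ht (x q) = chart k t (X q))
    (f : MvPolynomial P k) (hf : ∀ t ∈ a, chart k t f = 0) : aeval x f = 0 := by
  classical
  cases nonempty_fintype P
  obtain ⟨g, hg⟩ := hx.exists_eq_sum hP f
  rw [hg]
  refine Finset.sum_eq_zero fun p _ => ?_
  induction p using WellFoundedLT.induction with
  | ind p ih =>
    by_cases hp : p ∈ a
    · have h1 : ρ p hp (aeval x f) = 0 := by
        rw [← hf p hp, ← AlgHom.comp_apply]
        congr 1
        exact algHom_ext fun q => by simp [hρ p hp]
      rw [hg, map_sum, Finset.sum_eq_single_of_mem p (Finset.mem_univ _), map_mul, hρ p hp,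
        chart_X_of_le k le_rfl] at h1
      · have h2 : ρ p hp (atomEval k x p (g p)) = restrict k p (g p) := by
          rw [← AlgHom.comp_apply]
          congr 1
          refine algHom_ext fun v => ?_
          rw [AlgHom.comp_apply, restrict_X]
          by_cases hv : v ∈ atomsBelow p
          · rw [if_pos hv, atomEval_X_of_mem hv, hρ p hp, chart_X_of_le k (mem_atomsBelow.1 hv).2,
              atomMonomial, atomsBelow_of_isAtom (mem_atomsBelow.1 hv).1, Finset.prod_singleton]
          · simp only [atomEval, aeval_X, if_neg hv, map_zero]
        rw [h2, _root_.mul_eq_zero] at h1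
        rw [← atomEval_restrict x le_rfl, h1.resolve_left (atomMonomial_ne_zero k p), map_zero,
          mul_zero]
      · intro q _ hqp
        by_cases hq : q ≤ p
        · rw [ih q (lt_of_le_of_ne hq hqp) (Finset.mem_univ _), map_zero]
        · rw [map_mul, hρ p hp, chart_X_of_not_le k hq, zero_mul]
    · rw [hxa p hp, zero_mul]

end IsStanleyFamily

end Spanning

/-! ### The lattice of the ideals `I_a` -/

section PosetIdeal

variable {P : Type*} [PartialOrder P] [OrderBot P] [Finite P] (k : Type*) [Field k]

/-- Membership in the ideals attached to the order ideals of `P` is tested in the charts. -/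
theorem mk_mem_posetIdeal_iff (hP : IsSimplicialPoset P) (a : LowerSet P) (f : MvPolynomial P k) :
    (Ideal.Quotient.mk _ f : DehomRing P k) ∈ posetIdeal k a ↔ ∀ t ∈ a, chart k t f = 0 := by
  have hcomap : (posetIdeal k a).comap
      (Ideal.Quotient.mk (Ideal.span {(X ⊥ - 1 : MvPolynomial P k)})) =
        homIdeal k a ⊔ Ideal.span {X ⊥ - 1} := by
    rw [posetIdeal, Ideal.comap_map_of_surjective _ Ideal.Quotient.mk_surjective,
      ← RingHom.ker_eq_comap_bot, Ideal.mk_ker]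
  rw [← Ideal.mem_comap, hcomap]
  constructor
  · intro h t ht
    exact homIdeal_le_ker_chart k hP ht h
  · intro h
    set J := homIdeal k a ⊔ Ideal.span {(X ⊥ - 1 : MvPolynomial P k)} with hJ
    -- The quotient for `a` thus satisfies the relations of the whole poset, so the straightening
    -- applies to it.
    have htop : homIdeal k ⊤ ≤ J := by
      rw [hJ, homIdeal_eq k a]
      exact le_sup_of_le_left le_sup_left
    have hx : IsStanleyFamily fun p => Ideal.Quotient.mk J (X p) := by
      refine ⟨?_, fun p q hpq hqp => ?_⟩
      · rw [← map_one (Ideal.Quotient.mk J), Ideal.Quotient.eq]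
        exact Ideal.mem_sup_right (Ideal.subset_span rfl)
      · rw [← map_sum, ← map_mul, ← map_mul, Ideal.Quotient.eq]
        exact htop (Ideal.mem_sup_right
          (Ideal.subset_span ⟨p, trivial, q, trivial, hpq, hqp, rfl⟩))
    have haeval : aeval (fun p => Ideal.Quotient.mk J (X p)) = Ideal.Quotient.mkₐ k J :=
      algHom_ext fun p => by simp
    have h0 := hx.aeval_eq_zero hP a
      (fun p hp => Ideal.Quotient.eq_zero_iff_mem.2
        (Ideal.mem_sup_left (Ideal.mem_sup_left (Ideal.subset_span ⟨p, hp, rfl⟩))))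
      (fun t ht => Ideal.Quotient.liftₐ J (chart k t) (homIdeal_le_ker_chart k hP ht))
      (fun t ht q => rfl) f h
    rw [haeval] at h0
    exact Ideal.Quotient.eq_zero_iff_mem.1 h0

theorem posetIdeal_isRadical (hP : IsSimplicialPoset P) (a : LowerSet P) :
    (posetIdeal k a).IsRadical := by
  intro x hx
  obtain ⟨f, rfl⟩ := Ideal.Quotient.mk_surjective x
  obtain ⟨n, hn⟩ := hx
  rw [← map_pow, mk_mem_posetIdeal_iff k hP] at hn
  rw [mk_mem_posetIdeal_iff k hP]
  intro t ht
  have := hn t ht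
  rw [map_pow] at this
  exact eq_zero_of_pow_eq_zero this

theorem posetIdeal_inf (hP : IsSimplicialPoset P) (a b : LowerSet P) :
    posetIdeal k a ⊓ posetIdeal k b = posetIdeal k (a ⊔ b) := by
  ext x
  obtain ⟨f, rfl⟩ := Ideal.Quotient.mk_surjective x
  rw [Submodule.mem_inf, mk_mem_posetIdeal_iff k hP, mk_mem_posetIdeal_iff k hP,
    mk_mem_posetIdeal_iff k hP]
  simp only [LowerSet.mem_sup_iff, or_imp, forall_and]

theorem posetIdeal_add (a b : LowerSet P) :
    posetIdeal k a + posetIdeal k b = posetIdeal k (a ⊓ b) := by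
  rw [posetIdeal, posetIdeal, posetIdeal, Submodule.add_eq_sup, ← Ideal.map_sup,
    homIdeal_eq k a, homIdeal_eq k b, homIdeal_eq k (a ⊓ b), ← sup_sup_distrib_left,
    ← Ideal.span_union]
  congr 3
  ext f
  simp only [Set.mem_union, Set.mem_ofPred_eq, LowerSet.mem_inf_iff, not_and_or, or_and_right,
    exists_or]

theorem posetIdeal_inf_add (hP : IsSimplicialPoset P) (a b c : LowerSet P) :
    posetIdeal k a ⊓ (posetIdeal k b + posetIdeal k c) =
      posetIdeal k a ⊓ posetIdeal k b + posetIdeal k a ⊓ posetIdeal k c := by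
  rw [posetIdeal_add, posetIdeal_inf k hP, posetIdeal_inf k hP, posetIdeal_inf k hP,
    posetIdeal_add, sup_inf_left]

end PosetIdeal

/-! ### Gluing compatible polynomials -/

section Gluing

variable {P : Type*} {k : Type*} [Field k]

/-- Modulo `X v`, the map `κ` fixes every variable. -/
theorem X_dvd_sub_map {σ : Type*} (v : σ) (f : MvPolynomial σ k)
    (κ : MvPolynomial σ k →ₐ[k] MvPolynomial σ k) (hκ : ∀ w, w ≠ v → κ (X w) = X w)
    (hv : κ (X v) = 0) : X v ∣ f - κ f := by
  rw [← Ideal.mem_span_singleton, ← Ideal.Quotient.eq]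
  suffices H : Ideal.Quotient.mkₐ k (Ideal.span {(X v : MvPolynomial σ k)}) =
    (Ideal.Quotient.mkₐ k _).comp κ from DFunLike.congr_fun H f
  refine algHom_ext fun w => ?_
  rw [AlgHom.comp_apply]
  by_cases hw : w = v
  · rw [hw, hv, map_zero]
    exact Ideal.Quotient.eq_zero_iff_mem.2 (Ideal.mem_span_singleton_self _)
  · rw [hκ w hw]

variable [PartialOrder P] [OrderBot P] [Finite P]

/-- On polynomials in the atoms below `p`, setting `X v` to zero factors through `restrict k r`,
which kills `f`. -/
theorem X_dvd_of_restrict_eq_zero {p r v : P} {f : MvPolynomial P k}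
    (hp : restrict k p f = f) (hr : restrict k r f = 0)
    (hpr : ∀ w ∈ atomsBelow p, w ≠ v → w ∈ atomsBelow r) : X v ∣ f := by
  classical
  set κ : MvPolynomial P k →ₐ[k] MvPolynomial P k := aeval fun w => if w = v then 0 else X w
    with hκ
  have h := X_dvd_sub_map v f κ (fun w hw => by simp [hκ, hw]) (by simp [hκ])
  suffices H : κ.comp (restrict k p) = (κ.comp (restrict k p)).comp (restrict k r) by
    have h0 := DFunLike.congr_fun H f
    rw [AlgHom.comp_apply, AlgHom.comp_apply, hr, map_zero, hp] at h0
    rwa [h0, sub_zero] at h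
  refine algHom_ext fun w => ?_
  simp only [AlgHom.comp_apply, restrict_X]
  by_cases hwp : w ∈ atomsBelow p
  · by_cases hwv : w = v
    · subst hwv
      by_cases hwr : w ∈ atomsBelow r
      · rw [if_pos hwr, restrict_X]
      · rw [if_neg hwr, map_zero, map_zero, if_pos hwp]
        simp [hκ]
    · rw [if_pos (hpr w hwp hwv), restrict_X]
  · by_cases hwr : w ∈ atomsBelow r
    · rw [if_pos hwr, restrict_X]
    · rw [if_neg hwp, if_neg hwr, map_zero, map_zero, map_zero]

theorem prod_X_dvd {σ : Type*} {s : Finset σ} {f : MvPolynomial σ k} (h : ∀ v ∈ s, X v ∣ f) :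
    ∏ v ∈ s, X v ∣ f := by
  classical
  induction s using Finset.induction_on generalizing f with
  | empty => simp
  | insert v s hv ih =>
    obtain ⟨g, rfl⟩ := h v (Finset.mem_insert_self v s)
    rw [Finset.prod_insert hv]
    refine mul_dvd_mul_left _ (ih fun w hw => ?_)
    refine (X_prime.dvd_or_dvd (h w (Finset.mem_insert_of_mem hw))).resolve_left fun hwv => ?_
    rw [X_dvd_X] at hwv
    exact hv (hwv ▸ hw)

/-- For each atom `v` below `p`, vanishing on the facet opposite `v` gives divisibility by `X v`;
distinct variables are non-associated primes. -/
theorem atomMonomial_dvd (hP : IsSimplicialPoset P) {p : P} {f : MvPolynomial P k}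
    (hp : restrict k p f = f) (h : ∀ r < p, restrict k r f = 0) : atomMonomial k p ∣ f := by
  classical
  refine prod_X_dvd fun v hv => ?_
  obtain ⟨r, hr, hrs⟩ := exists_atomsBelow_eq hP (t := p) (Finset.erase_subset v _)
  refine X_dvd_of_restrict_eq_zero hp (h r (lt_of_le_of_ne hr ?_)) ?_
  · rintro rfl
    rw [hrs] at hv
    simp at hv
  · intro w hw hwv
    rw [hrs]
    exact Finset.mem_erase.2 ⟨hwv, hw⟩

/-- A compatible family of polynomials in the charts comes from a polynomial in the `x_p`. -/
theorem exists_chart_eq (hP : IsSimplicialPoset P) (Q : P → MvPolynomial P k)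
    (hQ : ∀ p q, p ≤ q → restrict k p (Q q) = Q p) : ∃ f, ∀ p, chart k p f = Q p := by
  classical
  induction h : {p | Q p ≠ 0}.ncard using Nat.strong_induction_on generalizing Q with
  | _ n ih =>
    by_cases hQ0 : ∀ p, Q p = 0
    · exact ⟨0, fun p => by rw [map_zero, hQ0]⟩
    have hne : {p | Q p ≠ 0}.Nonempty := by
      push Not at hQ0
      exact hQ0
    obtain ⟨p, hp, hmin⟩ := WellFounded.has_min (wellFounded_lt (α := P)) _ hne
    have hmin' : ∀ r < p, Q r = 0 := fun r hr => by
      by_contra h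
      exact hmin r h hr
    obtain ⟨g, hg⟩ := atomMonomial_dvd hP (hQ p p le_rfl)
      fun r hr => (hQ r p hr.le).trans (hmin' r hr)
    -- This `f` has chart `Q p` at the minimal `p` and vanishes in the charts not above `p`.
    -- Subtracting it removes `p` from the support and adds nothing: above `p`, all `Q q` are
    -- nonzero since they restrict to `Q p`.
    set f := X p * restrict k p g with hf
    have hfp : ∀ q, ¬ p ≤ q → chart k q f = 0 := fun q hq => by
      rw [hf, map_mul, chart_X_of_not_le k hq, zero_mul]
    have hchart : chart k p f = Q p := by
      rw [hf, map_mul, chart_X_of_le k le_rfl, ← hQ p p le_rfl, hg, map_mul,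
        restrict_atomMonomial_of_le k le_rfl]
      congr 1
      rw [← AlgHom.comp_apply]
      congr 1
      refine algHom_ext fun v => ?_
      rw [AlgHom.comp_apply, restrict_X]
      by_cases hv : v ∈ atomsBelow p
      · rw [if_pos hv, chart_X_of_le k (mem_atomsBelow.1 hv).2, atomMonomial,
          atomsBelow_of_isAtom (mem_atomsBelow.1 hv).1, Finset.prod_singleton]
      · rw [if_neg hv, map_zero]
    have hlt : {q | Q q - chart k q f ≠ 0} ⊂ {q | Q q ≠ 0} := by
      refine ⟨fun q hq hq0 => ?_, fun hsub => hsub hp (by rw [hchart, sub_self])⟩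
      by_cases hpq : p ≤ q
      · refine hp ?_
        rw [← hQ p q hpq, hq0, map_zero]
      · exact hq (by rw [hfp q hpq, sub_zero]; exact hq0)
    obtain ⟨f', hf'⟩ := ih _ (h ▸ Set.ncard_lt_ncard hlt) (fun q => Q q - chart k q f)
      (fun r q hrq => by rw [map_sub, hQ r q hrq, restrict_chart k hP hrq]) rfl
    exact ⟨f' + f, fun q => by rw [map_add, hf', sub_add_cancel]⟩

end Gluing

/-! ### Principal ideals of maximal elements as indices of the sheaf -/

section OrderIdeals

variable {P : Type*} [PartialOrder P]

theorem mem_down_iff {τ : Set P} {p : P}  : p ∈ down τ ↔ ∀ t ∈ τ, p ≤ t := by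
  simp [down, LowerSet.mem_iInf_iff]

/-- The principal order ideal of a maximal element. -/
def XPoset.ofMax (t : P) (ht : IsMax t) : XPoset P where
  ideal := LowerSet.Iic t
  exists_eq_down := ⟨{t}, Set.singleton_nonempty t, by simpa using ht, by simp [down]⟩

/-- The intersection of the principal order ideals of two maximal elements. -/
def XPoset.ofMaxPair (t u : P) (ht : IsMax t) (hu : IsMax u) : XPoset P where
  ideal := down {t, u}
  exists_eq_down := ⟨{t, u}, Set.insert_nonempty _ _, by
    rintro _ (rfl | rfl)
    exacts [ht, hu], rfl⟩

/-- The order reverses inclusion, so every component of a section is a projection of one at a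
maximal element. -/
theorem XPoset.exists_ofMax_le (a : XPoset P) : ∃ t, ∃ ht : IsMax t, XPoset.ofMax t ht ≤ a := by
  obtain ⟨τ, ⟨t, htτ⟩, hτ, ha⟩ := a.exists_eq_down
  refine ⟨t, hτ t htτ, ?_⟩
  change a.ideal ≤ LowerSet.Iic t
  rw [ha]
  exact fun p hp => mem_down_iff.1 hp t htτ

theorem exists_isMax_ge [Finite P] (p : P) : ∃ t, IsMax t ∧ p ≤ t := by
  obtain ⟨t, hpt, ht⟩ := Set.Finite.exists_le_maximal (Set.toFinite (Set.univ : Set P))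
    (Set.mem_univ p)
  exact ⟨t, fun u hu => ht.2 (Set.mem_univ u) hu, hpt⟩

theorem proj_mk [OrderBot P] (k : Type*) [Field k] {a b : LowerSet P} (h : b ≤ a)
    (f : MvPolynomial (Vert a) k) :
    proj k h (Ideal.Quotient.mk _ f) = Ideal.Quotient.mk _ (polyProj k a b f) := rfl

/-- A section is determined by its components at the maximal elements. -/
theorem sectionRing_ext [OrderBot P] {k : Type*} [Field k] {x y : sectionRing P k}
    (h : ∀ t (ht : IsMax t), x.1 (XPoset.ofMax t ht) = y.1 (XPoset.ofMax t ht)) : x = y := by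
  refine Subtype.ext (funext fun a => ?_)
  obtain ⟨t, ht, hta⟩ := a.exists_ofMax_le
  rw [← x.2 _ _ hta, ← y.2 _ _ hta, h]

end OrderIdeals

/-! ### Comparison of the face ring with global sections -/

section Sections

variable {P : Type*} [PartialOrder P] [OrderBot P] [Finite P] (k : Type*) [Field k]

theorem prod_vert_eq_atomMonomial {a : LowerSet P} {p : P} (hp : p ∈ a) :
    ∏ v ∈ (Set.toFinite {v : Vert a | v.1 ≤ p}).toFinset, (X v.1 : MvPolynomial P k) =
      atomMonomial k p := by
  refine Finset.prod_bij (fun v _ => v.1) (fun v hv => ?_) (fun v _ w _ h => Subtype.ext h)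
    (fun v hv => ?_) fun _ _ => rfl
  · exact mem_atomsBelow.2 ⟨v.2.1, by simpa using hv⟩
  · rw [mem_atomsBelow] at hv
    exact ⟨⟨v, hv.1, a.lower hv.2 hp⟩, by simpa using hv.2, rfl⟩

/-- A squarefree monomial that survives restriction involves only atoms below `p`, and any set of
these is the vertex set of some `q ≤ p`, hence a face. -/
theorem eval_stanleyReisnerIdeal (hP : IsSimplicialPoset P) {a : LowerSet P} {p : P} (hp : p ∈ a)
    (f : MvPolynomial (Vert a) k) (hf : f ∈ stanleyReisnerIdeal k (faces a)) :
    ((restrict k p).comp (rename Subtype.val)) f = 0 := by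
  classical
  suffices H : stanleyReisnerIdeal k (faces a) ≤
    RingHom.ker ((restrict k p).comp (rename (Subtype.val : Vert a → P))) from H hf
  refine Ideal.span_le.2 ?_
  rintro _ ⟨s, hs, rfl⟩
  change ((restrict k p).comp (rename Subtype.val)) (∏ v ∈ s, X v) = 0
  rw [map_prod]
  by_contra h
  have h := Finset.prod_ne_zero_iff.1 h
  have hsp : s.image Subtype.val ⊆ atomsBelow p := by
    intro v hv
    obtain ⟨w, hw, rfl⟩ := Finset.mem_image.1 hv
    by_contra hwp
    exact h w hw (by rw [AlgHom.comp_apply, rename_X, restrict_X, if_neg hwp])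
  obtain ⟨q, hq, hqs⟩ := exists_atomsBelow_eq hP hsp
  refine hs ⟨q, a.lower hq hp, fun v => ?_⟩
  rw [← Subtype.val_injective.mem_finset_image, ← hqs, mem_atomsBelow]
  exact ⟨fun h => h.2, fun h => ⟨v.2.1, h⟩⟩

/-- Restriction of an element of `R_a` to the simplex of `p ∈ a`. -/
noncomputable def localEval (hP : IsSimplicialPoset P) {a : LowerSet P} {p : P} (hp : p ∈ a) :
    idealRing k a →ₐ[k] MvPolynomial P k :=
  Ideal.Quotient.liftₐ _ _ (eval_stanleyReisnerIdeal k hP hp)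

theorem localEval_mk (hP : IsSimplicialPoset P) {a : LowerSet P} {p : P} (hp : p ∈ a)
    (f : MvPolynomial (Vert a) k) :
    localEval k hP hp (Ideal.Quotient.mk _ f) = restrict k p (rename Subtype.val f) := rfl

theorem restrict_localEval (hP : IsSimplicialPoset P) {a : LowerSet P} {p q : P} (hp : p ∈ a)
    (hq : q ∈ a) (h : p ≤ q) (x : idealRing k a) :
    restrict k p (localEval k hP hq x) = localEval k hP hp x := by
  obtain ⟨f, rfl⟩ := Ideal.Quotient.mk_surjective x
  rw [localEval_mk, localEval_mk, restrict_comp_restrict k h]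

theorem localEval_proj (hP : IsSimplicialPoset P) {a b : LowerSet P} (h : b ≤ a) {p : P}
    (hp : p ∈ b) (x : idealRing k a) :
    localEval k hP hp (proj k h x) = localEval k hP (h hp) x := by
  obtain ⟨f, rfl⟩ := Ideal.Quotient.mk_surjective x
  rw [proj_mk, localEval_mk, localEval_mk]
  suffices H : ((restrict k p).comp (rename Subtype.val)).comp (polyProj k a b) =
    (restrict k p).comp (rename Subtype.val) from DFunLike.congr_fun H f
  refine algHom_ext fun v => ?_
  simp only [AlgHom.comp_apply, polyProj, aeval_X, rename_X]
  by_cases hv : v.1 ∈ b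
  · rw [dif_pos hv, rename_X]
  · rw [dif_neg hv, map_zero, map_zero, restrict_X, if_neg]
    exact fun h => hv (b.lower (mem_atomsBelow.1 h).2 hp)

/-- Every vertex of `P_{≤ t}` is kept by `restrict k t`, so the map is induced by an injective
renaming of variables. -/
theorem localEval_Iic_injective (hP : IsSimplicialPoset P) (t : P) :
    Function.Injective (localEval k hP (LowerSet.mem_Iic_iff.2 (le_refl t))) := by
  rw [injective_iff_map_eq_zero]
  intro x hx
  obtain ⟨f, rfl⟩ := Ideal.Quotient.mk_surjective x
  have H : (restrict k t).comp (rename (Subtype.val : Vert (LowerSet.Iic t) → P)) =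
      rename Subtype.val := by
    refine algHom_ext fun v => ?_
    rw [AlgHom.comp_apply, rename_X, restrict_X, if_pos (mem_atomsBelow.2 v.2)]
  rw [localEval_mk, ← AlgHom.comp_apply, H] at hx
  rw [(map_eq_zero_iff _ (rename_injective _ Subtype.val_injective)).1 hx, map_zero]

open Classical in
/-- The map `k[x_p | p ∈ P] → R_a` sending `x_p` to the face monomial of `p`. -/
noncomputable def toIdealRing (a : LowerSet P) : MvPolynomial P k →ₐ[k] idealRing k a :=
  aeval fun p => if p ∈ a then faceMonomial k a p else 0

theorem toIdealRing_X_of_mem {a : LowerSet P} {p : P} (hp : p ∈ a) :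
    toIdealRing k a (X p) = faceMonomial k a p := by
  simp [toIdealRing, hp]

theorem toIdealRing_X_of_notMem {a : LowerSet P} {p : P} (hp : p ∉ a) :
    toIdealRing k a (X p) = 0 := by
  simp [toIdealRing, hp]

theorem localEval_toIdealRing (hP : IsSimplicialPoset P) (t : P) (f : MvPolynomial P k) :
    localEval k hP (LowerSet.mem_Iic_iff.2 (le_refl t)) (toIdealRing k (LowerSet.Iic t) f) =
      chart k t f := by
  suffices H : (localEval k hP (LowerSet.mem_Iic_iff.2 (le_refl t))).comp
    (toIdealRing k (LowerSet.Iic t)) = chart k t from DFunLike.congr_fun H f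
  refine algHom_ext fun q => ?_
  rw [AlgHom.comp_apply]
  by_cases hq : q ≤ t
  · rw [toIdealRing_X_of_mem k (LowerSet.mem_Iic_iff.2 hq), chart_X_of_le k hq, faceMonomial,
      localEval_mk, map_prod]
    simp only [rename_X]
    rw [prod_vert_eq_atomMonomial k (LowerSet.mem_Iic_iff.2 hq), restrict_atomMonomial_of_le k hq]
  · rw [toIdealRing_X_of_notMem k (fun h => hq (LowerSet.mem_Iic_iff.1 h)), chart_X_of_not_le k hq,
      map_zero]

theorem proj_faceMonomial (hP : IsSimplicialPoset P) {a b : LowerSet P} (h : b ≤ a) {t p : P}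
    (ha : a ≤ LowerSet.Iic t) (hp : p ∈ a) :
    proj k h (faceMonomial k a p) = toIdealRing k b (X p) := by
  classical
  rw [faceMonomial, proj_mk, map_prod]
  by_cases hv : ∀ v : Vert a, v.1 ≤ p → v.1 ∈ b
  · have hprod : ∏ v ∈ (Set.toFinite {v : Vert a | v.1 ≤ p}).toFinset, polyProj k a b (X v) =
        ∏ v ∈ (Set.toFinite {v : Vert b | v.1 ≤ p}).toFinset, X v := by
      symm
      refine Finset.prod_bij (fun v _ => ⟨v.1, v.2.1, h v.2.2⟩) (fun v hv => ?_)
        (fun v _ w _ h => Subtype.ext (congrArg (fun u : Vert a => u.1) h)) (fun v hvp => ?_) fun v _ => ?_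
      · simpa using hv
      · have hvp' : v.1 ≤ p := by simpa using hvp
        exact ⟨⟨v.1, v.2.1, hv v hvp'⟩, by simpa using hvp', rfl⟩
      · simp [polyProj, v.2.2]
    rw [hprod]
    by_cases hpb : p ∈ b
    · rw [toIdealRing_X_of_mem k hpb, faceMonomial]
    -- All atoms of `p` lie in `b` but `p` does not. Below the common bound `t` no other element has
    -- the same atoms, so the monomial is that of a non-face of `b`.
    · rw [toIdealRing_X_of_notMem k hpb, Ideal.Quotient.eq_zero_iff_mem]
      refine Ideal.subset_span ⟨_, ?_, rfl⟩
      rintro ⟨r, hr, hrs⟩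
      have hpr : p = r := by
        refine eq_of_atomsBelow_eq hP (ha hp) (ha (h hr)) ?_
        ext v
        simp only [mem_atomsBelow, and_congr_right_iff]
        intro hva
        constructor
        · intro hvp
          exact (hrs ⟨v, hva, hv ⟨v, hva, a.lower hvp hp⟩ hvp⟩).1 (by simpa using hvp)
        · intro hvr
          simpa using (hrs ⟨v, hva, b.lower hvr hr⟩).2 hvr
      exact hpb (hpr ▸ hr)
  · push Not at hv
    obtain ⟨v, hvp, hvb⟩ := hv
    rw [Finset.prod_eq_zero (i := v) (by simpa using hvp) (by simp [polyProj, hvb]), map_zero,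
      toIdealRing_X_of_notMem k fun hpb => hvb (b.lower hvp hpb)]

theorem proj_toIdealRing (hP : IsSimplicialPoset P) {a b : LowerSet P} (h : b ≤ a) {t : P}
    (ha : a ≤ LowerSet.Iic t) (f : MvPolynomial P k) :
    proj k h (toIdealRing k a f) = toIdealRing k b f := by
  suffices H : (proj k h).comp (toIdealRing k a) = toIdealRing k b from DFunLike.congr_fun H f
  refine algHom_ext fun p => ?_
  rw [AlgHom.comp_apply]
  by_cases hp : p ∈ a
  · rw [toIdealRing_X_of_mem k hp, proj_faceMonomial k hP h ha hp]
  · rw [toIdealRing_X_of_notMem k hp, toIdealRing_X_of_notMem k fun hb => hp (h hb), map_zero]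

/-- The map from `k[x_p | p ∈ P]` to the ring of global sections. -/
noncomputable def toSectionRing (hP : IsSimplicialPoset P) :
    MvPolynomial P k →ₐ[k] sectionRing P k :=
  (AlgHom.pi fun a : XPoset P => toIdealRing k a.ideal).codRestrict _ fun f a b h => by
    obtain ⟨t, ht, hta⟩ := a.exists_ofMax_le
    exact proj_toIdealRing k hP h hta f

theorem toSectionRing_apply (hP : IsSimplicialPoset P) (f : MvPolynomial P k) (a : XPoset P) :
    (toSectionRing k hP f).1 a = toIdealRing k a.ideal f := rfl

theorem toSectionRing_surjective (hP : IsSimplicialPoset P) :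
    Function.Surjective (toSectionRing (P := P) k hP) := by
  intro x
  choose T hT hle using exists_isMax_ge (P := P)
  set Q : P → MvPolynomial P k := fun p =>
    localEval k hP (a := LowerSet.Iic (T p)) (LowerSet.mem_Iic_iff.2 (hle p))
      (x.1 (XPoset.ofMax (T p) (hT p))) with hQdef
  have hQ : ∀ p t (ht : IsMax t) (hpt : p ≤ t), Q p =
      localEval k hP (a := LowerSet.Iic t) (LowerSet.mem_Iic_iff.2 hpt)
        (x.1 (XPoset.ofMax t ht)) := by
    intro p t ht hpt
    -- The components at `T p` and `t` agree on `P_{≤ T p} ∩ P_{≤ t}`, which contains `p`; so `Q p`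
    -- does not depend on the chosen maximal element.
    set b := XPoset.ofMaxPair (T p) t (hT p) ht with hb
    have hpb : p ∈ b.ideal := by
      refine mem_down_iff.2 ?_
      rintro _ (rfl | rfl)
      exacts [hle p, hpt]
    have h1 : XPoset.ofMax (T p) (hT p) ≤ b := fun q hq => mem_down_iff.1 hq _ (by simp)
    have h2 : XPoset.ofMax t ht ≤ b := fun q hq => mem_down_iff.1 hq _ (by simp)
    have e1 := localEval_proj k hP h1 hpb (x.1 _)
    have e2 := localEval_proj k hP h2 hpb (x.1 _)
    rw [x.2 _ _ h1] at e1
    rw [x.2 _ _ h2] at e2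
    exact e1.symm.trans e2
  obtain ⟨f, hf⟩ := exists_chart_eq hP Q fun p q hpq => by
    rw [hQ p (T q) (hT q) (hpq.trans (hle q))]
    exact restrict_localEval k hP _ _ hpq _
  refine ⟨f, sectionRing_ext fun t ht => localEval_Iic_injective k hP t ?_⟩
  rw [toSectionRing_apply]
  exact (localEval_toIdealRing k hP t f).trans ((hf t).trans (hQ t t ht le_rfl))

theorem toSectionRing_eq_zero_iff (hP : IsSimplicialPoset P) (f : MvPolynomial P k) :
    toSectionRing k hP f = 0 ↔ ∀ p, chart k p f = 0 := by
  constructor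
  · intro h p
    obtain ⟨t, ht, hpt⟩ := exists_isMax_ge p
    have h0 : toIdealRing k (LowerSet.Iic t) f = 0 :=
      congrFun (congrArg Subtype.val h) (XPoset.ofMax t ht)
    rw [← restrict_chart k hP hpt, ← localEval_toIdealRing k hP, h0, map_zero, map_zero]
  · intro h
    refine sectionRing_ext fun t ht => localEval_Iic_injective k hP t ?_
    rw [toSectionRing_apply]
    exact (localEval_toIdealRing k hP t f).trans ((h t).trans (map_zero _).symm)

theorem toSectionRing_dehom (hP : IsSimplicialPoset P) (f : MvPolynomial P k)
    (hf : f ∈ Ideal.span {(X ⊥ - 1 : MvPolynomial P k)}) : toSectionRing k hP f = 0 :=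
  (toSectionRing_eq_zero_iff k hP f).2 fun _ =>
    homIdeal_le_ker_chart k hP (a := ⊤) trivial (Ideal.mem_sup_right hf)

theorem lift_toSectionRing_mem_iff (hP : IsSimplicialPoset P) (y : DehomRing P k) :
    Ideal.Quotient.liftₐ _ _ (toSectionRing_dehom k hP) y = 0 ↔
      y ∈ posetIdeal k (⊤ : LowerSet P) := by
  obtain ⟨f, rfl⟩ := Ideal.Quotient.mk_surjective y
  rw [mk_mem_posetIdeal_iff k hP]
  exact (toSectionRing_eq_zero_iff k hP f).trans ⟨fun h t _ => h t, fun h t => h t trivial⟩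

/-- The map from Stanley's face ring to the ring of global sections. -/
noncomputable def stanleyToSection (hP : IsSimplicialPoset P) :
    StanleyRing P k →ₐ[k] sectionRing P k :=
  Ideal.Quotient.liftₐ _ (Ideal.Quotient.liftₐ _ _ (toSectionRing_dehom k hP))
    fun y hy => (lift_toSectionRing_mem_iff k hP y).2 hy

theorem stanleyToSection_bijective (hP : IsSimplicialPoset P) :
    Function.Bijective (stanleyToSection (P := P) k hP) := by
  constructor
  · rw [injective_iff_map_eq_zero]
    intro x hx
    obtain ⟨y, rfl⟩ := Ideal.Quotient.mk_surjective x
    exact Ideal.Quotient.eq_zero_iff_mem.2 ((lift_toSectionRing_mem_iff k hP y).1 hx)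
  · intro x
    obtain ⟨f, rfl⟩ := toSectionRing_surjective k hP x
    exact ⟨Ideal.Quotient.mk _ (Ideal.Quotient.mk _ f), rfl⟩

end Sections

end SimplicialPoset

theorem mainTheorem7 (k : Type*) [Field k] (P : Type*) [PartialOrder P] [OrderBot P] [Finite P]
    (hP : IsSimplicialPoset P) :
    (∃ e : SimplicialPoset.StanleyRing P k ≃ₐ[k] SimplicialPoset.sectionRing P k,
      ∀ (p : P) (a : SimplicialPoset.XPoset P),
        (p ∈ a.ideal → (e (SimplicialPoset.stanleyGen P k p)).1 a =
          SimplicialPoset.faceMonomial k a.ideal p) ∧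
        (p ∉ a.ideal → (e (SimplicialPoset.stanleyGen P k p)).1 a = 0)) ∧
    (∀ a : LowerSet P, (SimplicialPoset.posetIdeal k a).IsRadical) ∧
    (∀ a b : LowerSet P, SimplicialPoset.posetIdeal k a + SimplicialPoset.posetIdeal k b =
      SimplicialPoset.posetIdeal k (a ⊓ b)) ∧
    (∀ a b : LowerSet P, SimplicialPoset.posetIdeal k a ⊓ SimplicialPoset.posetIdeal k b =
      SimplicialPoset.posetIdeal k (a ⊔ b)) ∧
    (∀ a b c : LowerSet P, SimplicialPoset.posetIdeal k a ⊓
        (SimplicialPoset.posetIdeal k b + SimplicialPoset.posetIdeal k c) =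
      SimplicialPoset.posetIdeal k a ⊓ SimplicialPoset.posetIdeal k b +
        SimplicialPoset.posetIdeal k a ⊓ SimplicialPoset.posetIdeal k c) := by
  refine ⟨⟨AlgEquiv.ofBijective _ (SimplicialPoset.stanleyToSection_bijective k hP),
    fun p a => ⟨fun hp => ?_, fun hp => ?_⟩⟩, SimplicialPoset.posetIdeal_isRadical k hP,
    SimplicialPoset.posetIdeal_add k, SimplicialPoset.posetIdeal_inf k hP,
    SimplicialPoset.posetIdeal_inf_add k hP⟩
  · exact SimplicialPoset.toIdealRing_X_of_mem k hp
  · exact SimplicialPoset.toIdealRing_X_of_notMem k hp
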